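/- Let $n\ge 1$ be an integer. For a real vector $a=(a_1,\dots,a_n)$ with $\sum_{j=1}^n a_j=1$ consider the conjugate trigonometric polynomials $$C_a(t)=\sum_{j=1}^n a_j\cos jt,\qquad S_a(t)=\sum_{j=1}^n a_j\sin jt .$$ For every such $a$ the minimum $\rho(a)=\min\{C_a(t): t\in\mathbb R,\ S_a(t)=0\}$ exists, and $$\sup\Big\{\rho(a): a\in\mathbb R^n,\ \sum_{j=1}^n a_j=1\Big\}=-\tan^2\frac{\pi}{2(n+1)} .$$ Moreover, put $a_j^0=2\tan\frac{\pi}{2(n+1)}\Big(1-\frac{j}{n+1}\Big)\sin\frac{\pi j}{n+1}$ for $1\le j\le n$, and, for $\varepsilon>0$, let $a^\varepsilon=\frac{1}{1+\varepsilon}\big(a_1^0+\varepsilon,\,a_2^0,\dots,a_n^0\big)$. Then $\sum_{j=1}^n a_j^0=1$, $\sum_{j=1}^n a_j^\varepsilon=1$ for every $\varepsilon>0$, and $\rho(a^\varepsilon)\to-\tan^2\frac{\pi}{2(n+1)}$ as $\varepsilon\to0^+$. -/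

import Mathlib

open Filter Topology

namespace ConjugateTrig

/-- The cosine polynomial `C(t) = ∑_{j=1}^n a_j cos (j t)`; the coefficient `a_j` is stored at
index `j - 1` of `a : Fin n → ℝ`. -/
noncomputable def C {n : ℕ} (a : Fin n → ℝ) (t : ℝ) : ℝ :=
  ∑ j : Fin n, a j * Real.cos (((j : ℕ) + 1 : ℝ) * t)

/-- The conjugate sine polynomial `S(t) = ∑_{j=1}^n a_j sin (j t)`. -/
noncomputable def S {n : ℕ} (a : Fin n → ℝ) (t : ℝ) : ℝ :=
  ∑ j : Fin n, a j * Real.sin (((j : ℕ) + 1 : ℝ) * t)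

/-- The coefficient vectors of length `n` with `∑ a_j = 1`. -/
def normalized (n : ℕ) : Set (Fin n → ℝ) := {a | ∑ j : Fin n, a j = 1}

/-- The set of values `{C(t) : S(t) = 0}`. -/
def valuesAtZeros {n : ℕ} (a : Fin n → ℝ) : Set ℝ := {x | ∃ t : ℝ, S a t = 0 ∧ C a t = x}

/-- The number `min_t {C(t) : S(t) = 0}`, defined as an infimum; that it is attained is part of
the theorem. -/
noncomputable def rho {n : ℕ} (a : Fin n → ℝ) : ℝ := sInf (valuesAtZeros a)

/-- The coefficients `a_j⁰ = 2 tan(π/(2(n+1))) (1 - j/(n+1)) sin(π j/(n+1))`, `j = 1, …, n`. -/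
noncomputable def fejerCoeff (n : ℕ) (j : Fin n) : ℝ :=
  2 * Real.tan (Real.pi / (2 * ((n : ℝ) + 1))) * (1 - ((j : ℕ) + 1 : ℝ) / ((n : ℝ) + 1)) *
    Real.sin (Real.pi * ((j : ℕ) + 1 : ℝ) / ((n : ℝ) + 1))

/-- The perturbed vector `((a_1⁰ + ε)/(1+ε), a_2⁰/(1+ε), …, a_n⁰/(1+ε))`. -/
noncomputable def fejerPerturbed (n : ℕ) (ε : ℝ) (j : Fin n) : ℝ :=
  (fejerCoeff n j + if (j : ℕ) = 0 then ε else 0) / (1 + ε)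

end ConjugateTrig

/-!
Write `N = n + 1` and `τ = tan (π / (2 N))`; the supremum is `-τ ^ 2`.

*Upper bound* (`rho_le`). Suppose `C > -r` at every zero of `S`, with `r > 0`. Then the closed curve
`Q(t) = C(t) + r + i S(t)` avoids the negative real axis and `0`, so `arg Q` is continuous along it,
lies in `(-π, π)`, and vanishes at both ends `t = 0, 2π`, where `Q = 1 + r > 0`. Hence the phase
`φ(u) = N u - arg Q(2u)` goes continuously from `0` to `N π` on `[0, π]` and takes each value
`(2k+1) π / 2`, `0 ≤ k < N`, at some `u_k`, which is within `π / N` of the `k`-th zero angle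
`(2k+1) π / (2N)` of the Chebyshev polynomial `T_N`. On the other hand
`Re (Q(2u) e^{-iNu}) = p(cos u)` for the polynomial `p = r T_N + ∑ a_j T_{2j-N}` of degree `N`, so
the `cos u_k` are all the zeros of `p`. Since `p(1) = 1 + r = |p(-1)|`, this gives
`(1 + r) ^ 2 = r ^ 2 4 ^ (N-1) ∏ sin² u_k`, whereas
`1 = 4 ^ (N-1) ∏ sin² ((2k+1) π / (2N))` for `T_N`.
Moving each angle by at most one step `π / N` multiplies the product of the sines by at most
`1 / sin² (π / (2N))` (`prod_sin_mul_sin_sq_le`), because the best one can do is to push every angle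
towards `π / 2`, replacing the two extreme sines by `1`. So `(1 + r) sin² (π / (2N)) ≤ r`, that is
`r ≥ τ ^ 2`.

*Sharpness* (`rho_fejerPerturbed`). Closed forms of the Fejér kernel and of its conjugate show that
the Fejér coefficients sum to `1`, that their cosine polynomial equals `-τ ^ 2` at `π`, and that
their sine polynomial never has the sign opposite to that of `sin t`. Adding `ε sin t` removes all
zeros except the multiples of `π`, so the minimum for the perturbed vector is its value at `π`,
which tends to `-τ ^ 2`.
-/

namespace ConjugateTrig

open Polynomial Finset

/-! ### Products over the zeros of a polynomial in `cos u` -/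

lemma abs_eval_one_mul_eval_neg_one {N : ℕ} {p : ℝ[X]} (hp : p.degree = N) {u : ℕ → ℝ}
    (hinj : Set.InjOn (fun k => Real.cos (u k)) (range N : Finset ℕ))
    (hroot : ∀ k ∈ range N, p.eval (Real.cos (u k)) = 0) :
    |p.eval 1 * p.eval (-1)| = p.leadingCoeff ^ 2 * ∏ k ∈ range N, Real.sin (u k) ^ 2 := by
  have hp0 : p ≠ 0 := by
    rintro rfl
    simp at hp
  have hlc : p.leadingCoeff ≠ 0 := leadingCoeff_ne_zero.mpr hp0
  have hmonic : (∏ k ∈ range N, (X - Polynomial.C (Real.cos (u k)))).Monic :=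
    monic_prod_of_monic _ _ fun k _ => monic_X_sub_C _
  have hfac : p =
      Polynomial.C p.leadingCoeff * ∏ k ∈ range N, (X - Polynomial.C (Real.cos (u k))) := by
    refine eq_of_degree_le_of_eval_index_eq (range N) hinj (by simp [hp]) ?_ ?_ ?_
    · rw [degree_C_mul hlc, degree_prod]
      simp [hp]
    · rw [leadingCoeff_mul, hmonic.leadingCoeff, leadingCoeff_C, mul_one]
    · intro k hk
      rw [hroot k hk, eval_mul, eval_prod, prod_eq_zero hk (by simp), mul_zero]
  have heval : ∀ x : ℝ, p.eval x = p.leadingCoeff * ∏ k ∈ range N, (x - Real.cos (u k)) := by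
    intro x
    conv_lhs => rw [hfac]
    simp [eval_prod]
  rw [heval, heval, mul_mul_mul_comm, ← pow_two, ← prod_mul_distrib, abs_mul, abs_pow, sq_abs,
    abs_prod]
  congr 1
  refine prod_congr rfl fun k _ => ?_
  rw [Real.sin_sq, ← abs_neg, abs_of_nonneg]
  · ring
  · nlinarith [Real.cos_sq_le_one (u k)]

/-- The product of the squared sines of the zero angles of `T_N` is `4 ^ (1 - N)`. -/
lemma chebyshev_nodes_prod {N : ℕ} (hN : N ≠ 0) :
    ((2 : ℝ) ^ (N - 1)) ^ 2 *
      ∏ k ∈ range N, Real.sin ((2 * k + 1) * Real.pi / (2 * N)) ^ 2 = 1 := by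
  have hN' : (0 : ℝ) < N := by positivity
  have key := abs_eval_one_mul_eval_neg_one (N := N) (p := Chebyshev.T ℝ N)
    (u := fun k => (2 * k + 1) * Real.pi / (2 * N)) (by simp [Chebyshev.degree_T]) ?_ ?_
  · rw [Chebyshev.leadingCoeff_T] at key
    simpa [Chebyshev.T_eval_neg_one, Int.negOnePow] using key.symm
  · refine Real.injOn_cos.comp (fun i _ j _ h => ?_) ?_
    · have h1 : (2 * (i : ℝ) + 1) * Real.pi = (2 * j + 1) * Real.pi := by
        simpa [div_left_inj' (by positivity : (2 * (N : ℝ)) ≠ 0)] using h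
      have h2 := mul_right_cancel₀ Real.pi_ne_zero h1
      exact_mod_cast (by linarith : (i : ℝ) = j)
    · intro k hk
      have hk' : (k : ℝ) + 1 ≤ N := by
        have : k < N := by simpa using hk
        exact_mod_cast this
      refine ⟨by positivity, ?_⟩
      rw [div_le_iff₀ (by positivity)]
      nlinarith [Real.pi_pos]
  · intro k _
    rw [Chebyshev.T_real_cos, Real.cos_eq_zero_iff]
    refine ⟨k, ?_⟩
    push_cast
    field_simp

/-! ### Shifting the angles by one step -/

lemma prod_range_eq_prod_ends_mul_prod_Ico (f : ℕ → ℝ) {h N : ℕ} (hN : 2 * h ≤ N) :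
    ∏ k ∈ range N, f k = (∏ k ∈ range h, f k) * (∏ k ∈ Ico h (N - h), f k) *
      ∏ k ∈ range h, f (N - 1 - k) := by
  have hrefl : ∏ k ∈ range h, f (N - 1 - k) = ∏ k ∈ Ico (N - h) N, f k := by
    rcases Nat.eq_zero_or_pos N with rfl | hN0
    · simp [show h = 0 by omega]
    · rw [range_eq_Ico, prod_Ico_reflect f 0 (by omega)]
      congr 2 <;> omega
  rw [hrefl, range_eq_Ico, range_eq_Ico, prod_Ico_consecutive f (Nat.zero_le h) (by omega),
    prod_Ico_consecutive f (Nat.zero_le _) (by omega)]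

/-- Factors at distance `k` from either end of the range are bounded by `b (k + 1)`; the one or two
factors in the middle are bounded by `1`. -/
lemma prod_range_le_sq_prod {h : ℕ} {f b : ℕ → ℝ} {N : ℕ}
    (hN : N = 2 * h + 1 ∨ N = 2 * h + 2)
    (hf0 : ∀ k < N, 0 ≤ f k) (hf1 : ∀ k < N, f k ≤ 1)
    (hlow : ∀ k < h, f k ≤ b (k + 1)) (hup : ∀ k < h, f (N - 1 - k) ≤ b (k + 1)) :
    ∏ k ∈ range N, f k ≤ (∏ k ∈ range h, b (k + 1)) ^ 2 := by
  have hhN : 2 * h ≤ N := by omega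
  have hb : ∀ k < h, 0 ≤ b (k + 1) := fun k hk => (hf0 k (by omega)).trans (hlow k hk)
  have h1 : ∏ k ∈ range h, f k ≤ ∏ k ∈ range h, b (k + 1) :=
    prod_le_prod (fun k hk => hf0 k (by have := mem_range.mp hk; omega))
      (fun k hk => hlow k (mem_range.mp hk))
  have h2 : ∏ k ∈ range h, f (N - 1 - k) ≤ ∏ k ∈ range h, b (k + 1) :=
    prod_le_prod (fun k hk => hf0 _ (by have := mem_range.mp hk; omega))
      (fun k hk => hup k (mem_range.mp hk))
  have h3 : ∏ k ∈ Ico h (N - h), f k ≤ 1 :=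
    prod_le_one (fun k hk => hf0 k (by have := mem_Ico.mp hk; omega))
      (fun k hk => hf1 k (by have := mem_Ico.mp hk; omega))
  have h4 : 0 ≤ ∏ k ∈ range h, f (N - 1 - k) :=
    prod_nonneg fun k hk => hf0 _ (by have := mem_range.mp hk; omega)
  have h5 : 0 ≤ ∏ k ∈ range h, f k :=
    prod_nonneg fun k hk => hf0 _ (by have := mem_range.mp hk; omega)
  have h6 : 0 ≤ ∏ k ∈ range h, b (k + 1) :=
    prod_nonneg fun k hk => hb k (mem_range.mp hk)
  rw [prod_range_eq_prod_ends_mul_prod_Ico f hhN, pow_two]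
  exact mul_le_mul ((mul_le_of_le_one_right h5 h3).trans h1) h2 h4 h6

/-- If every `u k` is within `π / N` of the Chebyshev angle `(2k+1) π / (2N)`, the product of the
`sin (u k)` exceeds that of the Chebyshev angles by a factor of at most `1 / sin² (π / (2N))`. The
sine grows towards `π / 2`, so each half of the nodes is moved one step towards the middle; this
drops the two extreme nodes. -/
lemma prod_sin_mul_sin_sq_le {N : ℕ} (hN : N ≠ 0) {u : ℕ → ℝ}
    (hu : ∀ k < N, u k ∈ Set.Icc 0 Real.pi)
    (hlo : ∀ k < N, (2 * k - 1) * Real.pi / (2 * N) ≤ u k)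
    (hhi : ∀ k < N, u k ≤ (2 * k + 3) * Real.pi / (2 * N)) :
    (∏ k ∈ range N, Real.sin (u k)) * Real.sin (Real.pi / (2 * N)) ^ 2 ≤
      ∏ k ∈ range N, Real.sin ((2 * k + 1) * Real.pi / (2 * N)) := by
  have hN' : (0 : ℝ) < N := by positivity
  have hpi := Real.pi_pos
  set b : ℕ → ℝ := fun k => Real.sin ((2 * k + 1) * Real.pi / (2 * N)) with hb
  obtain ⟨h, hh⟩ : ∃ h, N = 2 * h + 1 ∨ N = 2 * h + 2 := ⟨(N - 1) / 2, by omega⟩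
  have hb0 : ∀ k < N, 0 ≤ b k := by
    intro k hk
    have hk' : (k : ℝ) + 1 ≤ N := by exact_mod_cast hk
    refine Real.sin_nonneg_of_nonneg_of_le_pi (by positivity) ?_
    rw [div_le_iff₀ (by positivity)]
    nlinarith
  have hbsymm : ∀ k < N, b (N - 1 - k) = b k := by
    intro k hk
    simp only [hb]
    rw [← Real.sin_pi_sub]
    congr 1
    have : ((N - 1 - k : ℕ) : ℝ) = N - 1 - k := by
      rw [Nat.cast_sub (by omega), Nat.cast_sub (by omega)]
      simp
    rw [this]
    field_simp
    ring
  have hangle : ∀ k < h, (2 * ((k + 1 : ℕ) : ℝ) + 1) * Real.pi / (2 * N) ≤ Real.pi / 2 := by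
    intro k hk
    have : 2 * ((k + 1 : ℕ) : ℝ) + 1 ≤ N := by
      exact_mod_cast (by omega : 2 * (k + 1) + 1 ≤ N)
    rw [div_le_div_iff₀ (by positivity) two_pos]
    nlinarith
  have hmain : ∏ k ∈ range N, Real.sin (u k) ≤ (∏ k ∈ range h, b (k + 1)) ^ 2 := by
    refine prod_range_le_sq_prod hh
      (fun k hk => Real.sin_nonneg_of_nonneg_of_le_pi (hu k hk).1 (hu k hk).2)
      (fun k _ => Real.sin_le_one _) (fun k hk => ?_) (fun k hk => ?_)
    · refine Real.sin_le_sin_of_le_of_le_pi_div_two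
        (by linarith [(hu k (by omega)).1]) (hangle k hk) ?_
      refine (hhi k (by omega)).trans_eq ?_
      push_cast
      ring
    · rw [← Real.sin_pi_sub]
      refine Real.sin_le_sin_of_le_of_le_pi_div_two
        (by linarith [(hu (N - 1 - k) (by omega)).2]) (hangle k hk) ?_
      have h1 := hlo (N - 1 - k) (by omega)
      have : ((N - 1 - k : ℕ) : ℝ) = N - 1 - k := by
        rw [Nat.cast_sub (by omega), Nat.cast_sub (by omega)]
        simp
      rw [this] at h1
      have h2 : (2 * ((N : ℝ) - 1 - k) - 1) * Real.pi / (2 * N) =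
          Real.pi - (2 * ((k + 1 : ℕ) : ℝ) + 1) * Real.pi / (2 * N) := by
        push_cast
        field_simp
        ring
      linarith
  have hb_zero : b 0 = Real.sin (Real.pi / (2 * N)) := by simp [hb]
  have hshift : (∏ k ∈ range h, b (k + 1)) * b 0 = (∏ k ∈ range h, b k) * b h := by
    rw [← prod_range_succ', prod_range_succ]
  have hprod : ∏ k ∈ range N, b k = ((∏ k ∈ range h, b k) * b h) ^ 2 := by
    have hrefl : ∏ k ∈ range N, b k = (∏ k ∈ range h, b k) * (∏ k ∈ Ico h (N - h), b k) *
        ∏ k ∈ range h, b k := by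
      rw [prod_range_eq_prod_ends_mul_prod_Ico b (by omega : 2 * h ≤ N)]
      congr 1
      exact prod_congr rfl fun k hk => hbsymm k (by have := mem_range.mp hk; omega)
    rw [hrefl]
    rcases hh with hh | hh
    · have h1 : N - h = h + 1 := by omega
      have h2 : b h = 1 := by
        have : (2 * (h : ℝ) + 1) * Real.pi / (2 * N) = Real.pi / 2 := by
          rw [hh]
          push_cast
          field_simp
        simp only [hb, this, Real.sin_pi_div_two]
      rw [h1, Nat.Ico_succ_singleton, prod_singleton, h2]
      ring
    · have h1 : N - h = h + 1 + 1 := by omega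
      have h2 : b (h + 1) = b h := by
        rw [← hbsymm h (by omega)]
        congr 1
        omega
      rw [h1, prod_Ico_succ_top (by omega), Nat.Ico_succ_singleton, prod_singleton, h2]
      ring
  rw [hprod, ← hshift, ← hb_zero, mul_pow]
  exact mul_le_mul_of_nonneg_right hmain (sq_nonneg _)

/-! ### The polynomial of the curve `C + r + i S` -/

/-- The polynomial `p = r T_N + ∑_{j=1}^n a_j T_{2j-N}` with `N = n + 1`, which satisfies
`p(cos u) = Re ((C(2u) + r + i S(2u)) e^{-iNu})`. The Chebyshev polynomials of negative index are
`T_{-m} = T_m`, so that the sum has degree less than `N`. -/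
noncomputable def anglePoly {n : ℕ} (a : Fin n → ℝ) (r : ℝ) : ℝ[X] :=
  Polynomial.C r * Chebyshev.T ℝ ((n + 1 : ℕ) : ℤ) +
    ∑ j : Fin n, Polynomial.C (a j) * Chebyshev.T ℝ (2 * ((j : ℤ) + 1) - (n + 1))

lemma anglePoly_eval_cos {n : ℕ} (a : Fin n → ℝ) (r u : ℝ) :
    (anglePoly a r).eval (Real.cos u) =
      (C a (2 * u) + r) * Real.cos ((n + 1) * u) +
        S a (2 * u) * Real.sin ((n + 1) * u) := by
  simp only [anglePoly, eval_add, eval_finsetSum, eval_mul, eval_C, Chebyshev.T_real_cos,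
    C, S]
  rw [add_mul, sum_mul, sum_mul, add_right_comm, ← sum_add_distrib, add_comm]
  congr 1
  · refine sum_congr rfl fun j _ => ?_
    rw [mul_assoc, mul_assoc, ← mul_add, ← Real.cos_sub]
    push_cast
    ring_nf
  · push_cast
    rfl

lemma degree_anglePoly_sum_lt {n : ℕ} (a : Fin n → ℝ) :
    (∑ j : Fin n, Polynomial.C (a j) * Chebyshev.T ℝ (2 * ((j : ℤ) + 1) - (n + 1))).degree <
      ((n + 1 : ℕ) : WithBot ℕ) := by
  refine (degree_sum_le _ _).trans_lt ((Finset.sup_lt_iff (WithBot.bot_lt_coe _)).mpr fun j _ => ?_)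
  rcases eq_or_ne (a j) 0 with h0 | h0
  · simp [h0]
  rw [degree_C_mul h0, Chebyshev.degree_T]
  have := j.2
  exact_mod_cast (by omega : (2 * ((j : ℤ) + 1) - (n + 1)).natAbs < n + 1)

lemma degree_C_mul_T {r : ℝ} (hr : r ≠ 0) (N : ℕ) :
    (Polynomial.C r * Chebyshev.T ℝ (N : ℤ)).degree = N := by
  rw [degree_C_mul hr, Chebyshev.degree_T]
  simp

lemma degree_anglePoly {n : ℕ} (a : Fin n → ℝ) {r : ℝ} (hr : r ≠ 0) :
    (anglePoly a r).degree = ((n + 1 : ℕ) : WithBot ℕ) := by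
  rw [anglePoly, degree_add_eq_left_of_degree_lt, degree_C_mul_T hr]
  rw [degree_C_mul_T hr]
  exact degree_anglePoly_sum_lt a

lemma leadingCoeff_anglePoly {n : ℕ} (a : Fin n → ℝ) {r : ℝ} (hr : r ≠ 0) :
    (anglePoly a r).leadingCoeff = r * 2 ^ n := by
  rw [anglePoly, leadingCoeff_add_of_degree_lt', leadingCoeff_mul, leadingCoeff_C,
    Chebyshev.leadingCoeff_T, Int.natAbs_natCast, Nat.add_sub_cancel]
  · rw [degree_C_mul_T hr]
    exact degree_anglePoly_sum_lt a

lemma eval_one_anglePoly {n : ℕ} {a : Fin n → ℝ} (ha : a ∈ normalized n) (r : ℝ) :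
    (anglePoly a r).eval 1 = 1 + r := by
  have ha' : ∑ j, a j = 1 := ha
  simp [anglePoly, eval_finsetSum, ha', add_comm]

lemma abs_eval_neg_one_anglePoly {n : ℕ} {a : Fin n → ℝ} (ha : a ∈ normalized n) {r : ℝ} :
    |(anglePoly a r).eval (-1)| = |1 + r| := by
  have ha' : ∑ j, a j = 1 := ha
  have h := anglePoly_eval_cos a r Real.pi
  rw [Real.cos_pi] at h
  have hS : Real.sin ((n + 1) * Real.pi) = 0 := by
    exact_mod_cast Real.sin_nat_mul_pi (n + 1)
  have hC : C a (2 * Real.pi) = 1 := by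
    rw [← ha']
    refine sum_congr rfl fun j _ => ?_
    have : Real.cos (((j : ℕ) + 1 : ℝ) * (2 * Real.pi)) = 1 := by
      exact_mod_cast Real.cos_nat_mul_two_pi (j + 1)
    rw [this, mul_one]
  have hc : |Real.cos ((n + 1) * Real.pi)| = 1 := by
    have := Real.abs_cos_int_mul_pi (n + 1)
    push_cast at this
    exact this
  rw [h, hS, hC, mul_zero, add_zero, abs_mul, hc, mul_one]

/-! ### Elementary properties of `C`, `S` and `rho` -/

lemma continuous_C {n : ℕ} (a : Fin n → ℝ) : Continuous (C a) := by
  unfold C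
  fun_prop

lemma continuous_S {n : ℕ} (a : Fin n → ℝ) : Continuous (S a) := by
  unfold S
  fun_prop

lemma C_zero {n : ℕ} {a : Fin n → ℝ} (ha : a ∈ normalized n) : C a 0 = 1 := by
  simpa [C, normalized] using ha

lemma S_zero {n : ℕ} (a : Fin n → ℝ) : S a 0 = 0 := by simp [S]

lemma C_periodic {n : ℕ} (a : Fin n → ℝ) :
    Function.Periodic (C a) (2 * Real.pi) := by
  intro t
  refine sum_congr rfl fun j _ => ?_
  have := Real.cos_add_nat_mul_two_pi (((j : ℕ) + 1 : ℝ) * t) (j + 1)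
  push_cast at this
  rw [mul_add, this]

lemma S_periodic {n : ℕ} (a : Fin n → ℝ) : Function.Periodic (S a) (2 * Real.pi) := by
  intro t
  refine sum_congr rfl fun j _ => ?_
  have := Real.sin_add_nat_mul_two_pi (((j : ℕ) + 1 : ℝ) * t) (j + 1)
  push_cast at this
  rw [mul_add, this]

lemma isLeast_rho {n : ℕ} (a : Fin n → ℝ) : IsLeast (valuesAtZeros a) (rho a) := by
  have himage : valuesAtZeros a =
      C a '' (Set.Icc 0 (2 * Real.pi) ∩ S a ⁻¹' {0}) := by
    ext x
    constructor
    · rintro ⟨t, hS, rfl⟩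
      obtain ⟨s, hs, hst⟩ := (show Function.Periodic (fun t => (C a t, S a t))
        (2 * Real.pi) from fun t => by simp only [C_periodic a t, S_periodic a t]).exists_mem_Ico₀
          Real.two_pi_pos t
      simp only [Prod.mk.injEq] at hst
      exact ⟨s, ⟨⟨hs.1, hs.2.le⟩, by simpa [← hst.2] using hS⟩, hst.1.symm⟩
    · rintro ⟨t, ⟨-, hS⟩, rfl⟩
      exact ⟨t, hS, rfl⟩
  have hcomp : IsCompact (valuesAtZeros a) := by
    rw [himage]
    exact (isCompact_Icc.inter_right (isClosed_singleton.preimage (continuous_S a))).image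
      (continuous_C a)
  exact hcomp.isLeast_sInf ⟨C a 0, 0, S_zero a, rfl⟩

/-! ### The upper bound -/

/-- If `C > -r` at the zeros of `S`, then `anglePoly a r` vanishes at the cosines of `n + 1`
distinct angles of `[0, π]`, the `k`-th of them less than `π / (n + 1)` away from `(2k+1) π / (2(n+1))`. -/
lemma exists_angles_root_anglePoly {n : ℕ} {a : Fin n → ℝ} (ha : a ∈ normalized n) {r : ℝ}
    (hr : 0 < r)
    (h : ∀ t, S a t = 0 → -r < C a t) :
    ∃ u : ℕ → ℝ, ∀ k < n + 1, u k ∈ Set.Icc 0 Real.pi ∧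
      (2 * k - 1) * Real.pi / (2 * ((n + 1 : ℕ) : ℝ)) < u k ∧
      u k < (2 * k + 3) * Real.pi / (2 * ((n + 1 : ℕ) : ℝ)) ∧
      (anglePoly a r).eval (Real.cos (u k)) = 0 ∧
      ∀ i < n + 1, u i = u k → i = k := by
  set Q : ℝ → ℂ := fun t => ⟨C a t + r, S a t⟩ with hQ
  have hslit : ∀ t, Q t ∈ Complex.slitPlane := by
    intro t
    rw [Complex.mem_slitPlane_iff]
    by_cases hS : S a t = 0
    · left
      have := h t hS
      simp only [hQ]
      linarith
    · exact Or.inr hS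
  have hQcont : Continuous Q := by
    have : Q = fun t => ((C a t + r : ℝ) : ℂ) + (S a t : ℝ) * Complex.I := by
      funext t
      exact Complex.ext (by simp [hQ]) (by simp [hQ])
    rw [this]
    have h1 := continuous_C a
    have h2 := continuous_S a
    fun_prop
  -- The zeros of `p(cos u) = ‖Q(2u)‖ cos φ(u)` are the points where `φ` is an odd
  -- multiple of `π / 2`.
  set φ : ℝ → ℝ := fun u => (n + 1) * u - (Q (2 * u)).arg with hφ
  have hφcont : Continuous φ := by
    have harg : Continuous fun u : ℝ => (Q (2 * u)).arg :=
      continuous_iff_continuousAt.mpr fun u =>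
        (Complex.continuousAt_arg (hslit (2 * u))).comp (f := fun u : ℝ => Q (2 * u))
          (by fun_prop)
    fun_prop
  have harg0 : (Q 0).arg = 0 := by
    rw [Complex.arg_eq_zero_iff]
    refine ⟨?_, S_zero a⟩
    simp only [hQ, C_zero ha]
    linarith
  have hQ2pi : Q (2 * Real.pi) = Q 0 := by
    have h1 := C_periodic a 0
    have h2 := S_periodic a 0
    rw [zero_add] at h1 h2
    simp only [hQ, h1, h2]
  have hφ0 : φ 0 = 0 := by simp [hφ, harg0]
  have hφpi : φ Real.pi = (n + 1) * Real.pi := by simp [hφ, hQ2pi, harg0]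
  have hpi := Real.pi_pos
  have hex : ∀ k : ℕ, ∃ u : ℝ, k < n + 1 → u ∈ Set.Icc 0 Real.pi ∧
      φ u = (2 * k + 1) * Real.pi / 2 := by
    intro k
    by_cases hk : k < n + 1
    · have hk' : (k : ℝ) + 1 ≤ n + 1 := by exact_mod_cast hk
      have hmem : (2 * k + 1) * Real.pi / 2 ∈ Set.Icc (φ 0) (φ Real.pi) := by
        rw [hφ0, hφpi]
        exact ⟨by positivity, by nlinarith⟩
      obtain ⟨u, hu, hu'⟩ := intermediate_value_Icc hpi.le hφcont.continuousOn hmem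
      exact ⟨u, fun _ => ⟨hu, hu'⟩⟩
    · exact ⟨0, fun h => absurd h hk⟩
  choose u hu using hex
  refine ⟨u, fun k hk => ⟨(hu k hk).1, ?_, ?_, ?_, ?_⟩⟩
  · have h1 := (hu k hk).2
    have h2 := Complex.neg_pi_lt_arg (Q (2 * u k))
    rw [div_lt_iff₀ (by positivity)]
    simp only [hφ] at h1
    push_cast
    linarith
  · have h1 := (hu k hk).2
    have h2 : (Q (2 * u k)).arg < Real.pi :=
      lt_of_le_of_ne (Complex.arg_le_pi _) (Complex.mem_slitPlane_iff_arg.mp (hslit _)).1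
    rw [lt_div_iff₀ (by positivity)]
    simp only [hφ] at h1
    push_cast
    linarith
  · have hre := Complex.norm_mul_cos_arg (Q (2 * u k))
    have him := Complex.norm_mul_sin_arg (Q (2 * u k))
    have hcos : Real.cos (φ (u k)) = 0 := by
      rw [(hu k hk).2, Real.cos_eq_zero_iff]
      exact ⟨k, by push_cast; rfl⟩
    simp only [hφ, Real.cos_sub] at hcos
    rw [anglePoly_eval_cos]
    change (Q (2 * u k)).re * _ + (Q (2 * u k)).im * _ = 0
    rw [← hre, ← him]
    linear_combination ‖Q (2 * u k)‖ * hcos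
  · intro i hi hik
    have h1 := (hu k hk).2
    rw [← hik, (hu i hi).2] at h1
    have h2 : (2 * (i : ℝ) + 1) * Real.pi = (2 * k + 1) * Real.pi := by linarith
    have h3 := mul_right_cancel₀ Real.pi_ne_zero h2
    exact_mod_cast (by linarith : (i : ℝ) = k)

lemma one_add_mul_sin_sq_le {n : ℕ} {a : Fin n → ℝ} (ha : a ∈ normalized n) {r : ℝ} (hr : 0 < r)
    (h : ∀ t, S a t = 0 → -r < C a t) :
    (1 + r) * Real.sin (Real.pi / (2 * ((n : ℝ) + 1))) ^ 2 ≤ r := by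
  obtain ⟨u, hu⟩ := exists_angles_root_anglePoly ha hr h
  have hinj : Set.InjOn (fun k => Real.cos (u k)) (range (n + 1) : Finset ℕ) := by
    intro i hi k hk hik
    rw [mem_coe, mem_range] at hi hk
    exact (hu k hk).2.2.2.2 i hi (Real.injOn_cos (hu i hi).1 (hu k hk).1 hik)
  have key := abs_eval_one_mul_eval_neg_one (degree_anglePoly a hr.ne') hinj
    fun k hk => (hu k (mem_range.mp hk)).2.2.2.1
  have hnodes := chebyshev_nodes_prod (N := n + 1) (by omega)
  have hle := prod_sin_mul_sin_sq_le (N := n + 1) (by omega) (fun k hk => (hu k hk).1)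
    (fun k hk => (hu k hk).2.1.le) (fun k hk => (hu k hk).2.2.1.le)
  rw [abs_mul, eval_one_anglePoly ha, abs_eval_neg_one_anglePoly ha,
    leadingCoeff_anglePoly a hr.ne', abs_of_pos (by linarith), prod_pow] at key
  rw [prod_pow, Nat.add_sub_cancel] at hnodes
  have h0 : 0 ≤ ∏ k ∈ range (n + 1), Real.sin (u k) :=
    prod_nonneg fun k hk => Real.sin_nonneg_of_nonneg_of_le_pi
      (hu k (mem_range.mp hk)).1.1 (hu k (mem_range.mp hk)).1.2
  push_cast at hle hnodes
  set s := Real.sin (Real.pi / (2 * ((n : ℝ) + 1))) ^ 2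
  set A := ∏ k ∈ range (n + 1), Real.sin (u k)
  set B := ∏ k ∈ range (n + 1), Real.sin ((2 * k + 1) * Real.pi / (2 * ((n : ℝ) + 1)))
  have hs : 0 ≤ s := sq_nonneg _
  refine (sq_le_sq₀ (by positivity) hr.le).mp ?_
  calc ((1 + r) * s) ^ 2 = r ^ 2 * (2 ^ n) ^ 2 * (A * s) ^ 2 := by
        linear_combination s ^ 2 * key
    _ ≤ r ^ 2 * (2 ^ n) ^ 2 * B ^ 2 := by gcongr
    _ = r ^ 2 := by linear_combination r ^ 2 * hnodes

lemma half_angle_mem_Ioo {n : ℕ} (hn : 1 ≤ n) :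
    Real.pi / (2 * ((n : ℝ) + 1)) ∈ Set.Ioo 0 (Real.pi / 2) := by
  have hn' : (1 : ℝ) ≤ n := by exact_mod_cast hn
  have hpi := Real.pi_pos
  refine ⟨by positivity, ?_⟩
  rw [div_lt_div_iff₀ (by positivity) two_pos]
  nlinarith

lemma rho_le {n : ℕ} (hn : 1 ≤ n) {a : Fin n → ℝ} (ha : a ∈ normalized n) :
    rho a ≤ -(Real.tan (Real.pi / (2 * ((n : ℝ) + 1)))) ^ 2 := by
  by_contra! hlt
  obtain ⟨hx0, hx1⟩ := half_angle_mem_Ioo hn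
  set x := Real.pi / (2 * ((n : ℝ) + 1))
  have htan : 0 < Real.tan x := Real.tan_pos_of_pos_of_lt_pi_div_two hx0 hx1
  have hcos : 0 < Real.cos x := Real.cos_pos_of_mem_Ioo ⟨by linarith, hx1⟩
  -- The maximum with `0` keeps `r` positive when `rho a` is positive.
  obtain ⟨r, hr1, hr2⟩ := exists_between
    (max_lt (by linarith) (by positivity) : max (-rho a) 0 < Real.tan x ^ 2)
  have hr0 : 0 < r := (le_max_right _ _).trans_lt hr1
  have h1 := one_add_mul_sin_sq_le ha hr0 fun t ht => by
    have h2 := (isLeast_rho a).2 ⟨t, ht, rfl⟩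
    have h3 := (le_max_left (-rho a) 0).trans_lt hr1
    linarith
  rw [Real.tan_eq_sin_div_cos, div_pow, lt_div_iff₀ (by positivity)] at hr2
  nlinarith [Real.sin_sq_add_cos_sq x]

/-! ### The Fejér kernel and its conjugate -/

lemma one_sub_cos_mul_sum_cos (n : ℕ) (x : ℝ) :
    (1 - Real.cos x) * (1 + 2 * ∑ j ∈ range n, Real.cos ((j + 1 : ℝ) * x)) =
      Real.cos (n * x) - Real.cos ((n + 1) * x) := by
  induction n with
  | zero => simp
  | succ n ih =>
    have h1 := Real.cos_add ((n + 1) * x) x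
    have h2 := Real.cos_sub ((n + 1) * x) x
    rw [show (n + 1) * x + x = ((n + 1 : ℕ) + 1) * x by push_cast; ring] at h1
    rw [show (n + 1) * x - x = n * x by ring] at h2
    rw [sum_range_succ]
    push_cast at h1 ⊢
    linear_combination ih + h1 + h2

/-- Closed form of the Fejér kernel `N + 2 ∑_{j=1}^{N-1} (N - j) cos (j x)`, `N = n + 1`, cleared of
its denominator. -/
lemma one_sub_cos_mul_fejerKernel (n : ℕ) (x : ℝ) :
    (1 - Real.cos x) * (n + 1 + ∑ j ∈ range n, 2 * (n - j : ℝ) * Real.cos ((j + 1 : ℝ) * x)) =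
      1 - Real.cos ((n + 1) * x) := by
  induction n with
  | zero => simp
  | succ n ih =>
    have h := one_sub_cos_mul_sum_cos (n + 1) x
    have hsum : ∑ j ∈ range (n + 1), 2 * ((n + 1 : ℕ) - j : ℝ) * Real.cos ((j + 1 : ℝ) * x) =
        ∑ j ∈ range n, 2 * (n - j : ℝ) * Real.cos ((j + 1 : ℝ) * x) +
          2 * ∑ j ∈ range (n + 1), Real.cos ((j + 1 : ℝ) * x) := by
      rw [sum_range_succ, sum_range_succ _ n, mul_add, mul_sum, ← add_assoc, ← sum_add_distrib]
      push_cast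
      congr 1
      · exact sum_congr rfl fun j _ => by ring
      · ring
    rw [hsum]
    push_cast at h ⊢
    linear_combination ih + h

lemma one_sub_cos_mul_sum_sin (n : ℕ) (x : ℝ) :
    (1 - Real.cos x) * (2 * ∑ j ∈ range n, Real.sin ((j + 1 : ℝ) * x)) =
      Real.sin x + Real.sin (n * x) - Real.sin ((n + 1) * x) := by
  induction n with
  | zero => simp
  | succ n ih =>
    have h1 := Real.sin_add ((n + 1) * x) x
    have h2 := Real.sin_sub ((n + 1) * x) x
    rw [show (n + 1) * x + x = ((n + 1 : ℕ) + 1) * x by push_cast; ring] at h1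
    rw [show (n + 1) * x - x = n * x by ring] at h2
    rw [sum_range_succ]
    push_cast at h1 ⊢
    linear_combination ih + h1 + h2

/-- Closed form of the conjugate Fejér kernel `2 ∑_{j=1}^{N-1} (N - j) sin (j x)`, `N = n + 1`,
cleared of its denominator. -/
lemma one_sub_cos_mul_conjFejerKernel (n : ℕ) (x : ℝ) :
    (1 - Real.cos x) * ∑ j ∈ range n, 2 * (n - j : ℝ) * Real.sin ((j + 1 : ℝ) * x) =
      (n + 1) * Real.sin x - Real.sin ((n + 1) * x) := by
  induction n with
  | zero => simp
  | succ n ih =>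
    have h := one_sub_cos_mul_sum_sin (n + 1) x
    have hsum : ∑ j ∈ range (n + 1), 2 * ((n + 1 : ℕ) - j : ℝ) * Real.sin ((j + 1 : ℝ) * x) =
        ∑ j ∈ range n, 2 * (n - j : ℝ) * Real.sin ((j + 1 : ℝ) * x) +
          2 * ∑ j ∈ range (n + 1), Real.sin ((j + 1 : ℝ) * x) := by
      rw [sum_range_succ, sum_range_succ _ n, mul_add, mul_sum, ← add_assoc, ← sum_add_distrib]
      push_cast
      congr 1
      · exact sum_congr rfl fun j _ => by ring
      · ring
    rw [hsum]
    push_cast at h ⊢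
    linear_combination ih + h

/-! ### The Fejér coefficients -/

lemma sum_fejerCoeff_mul (n : ℕ) (w : ℕ → ℝ) :
    ∑ j : Fin n, fejerCoeff n j * w j = Real.tan (Real.pi / (2 * ((n : ℝ) + 1))) / (n + 1) *
      ∑ j ∈ range n, 2 * (n - j : ℝ) * (Real.sin ((j + 1 : ℝ) * (Real.pi / (n + 1))) * w j) := by
  rw [mul_sum, ← Fin.sum_univ_eq_sum_range (fun j => _ * (2 * ((n : ℝ) - (j : ℕ)) * (_ * w j)))]
  refine sum_congr rfl fun j _ => ?_
  have h : Real.pi * ((j : ℕ) + 1 : ℝ) / ((n : ℝ) + 1) =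
      ((j : ℕ) + 1 : ℝ) * (Real.pi / (n + 1)) := by
    ring
  rw [fejerCoeff, h]
  field_simp
  ring

lemma sum_fejerPerturbed_mul {n : ℕ} (hn : 1 ≤ n) (ε : ℝ) (w : ℕ → ℝ) :
    ∑ j : Fin n, fejerPerturbed n ε j * w j =
      (∑ j : Fin n, fejerCoeff n j * w j + ε * w 0) / (1 + ε) := by
  obtain ⟨m, rfl⟩ : ∃ m, n = m + 1 := ⟨n - 1, by omega⟩
  have h : ∑ j : Fin (m + 1), (if (j : ℕ) = 0 then ε else 0) * w j = ε * w 0 := by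
    simp
  rw [← h, ← sum_add_distrib, sum_div]
  refine sum_congr rfl fun j _ => ?_
  rw [fejerPerturbed]
  ring

/-- The sum of the Fejér coefficients is `tan (θ / 2) / N` times the conjugate Fejér kernel at
`θ = π / N`, whose value there is `N cot (θ / 2)`. -/
lemma fejerCoeff_mem_normalized {n : ℕ} (hn : 1 ≤ n) : fejerCoeff n ∈ normalized n := by
  obtain ⟨h0, h1⟩ := half_angle_mem_Ioo hn
  have hsum := sum_fejerCoeff_mul n fun _ => 1
  have hker := one_sub_cos_mul_conjFejerKernel n (Real.pi / (n + 1))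
  have hpi : ((n : ℝ) + 1) * (Real.pi / (n + 1)) = Real.pi := by field_simp
  have hθ : Real.pi / ((n : ℝ) + 1) = 2 * (Real.pi / (2 * ((n : ℝ) + 1))) := by field_simp
  rw [hpi, Real.sin_pi, sub_zero] at hker
  simp only [mul_one] at hsum
  rw [hθ] at hsum hker
  set x := Real.pi / (2 * ((n : ℝ) + 1)) with hx
  have hsin : 0 < Real.sin x := Real.sin_pos_of_pos_of_lt_pi h0 (by linarith [Real.pi_pos])
  have hcos : 0 < Real.cos x := Real.cos_pos_of_mem_Ioo ⟨by linarith, h1⟩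
  rw [Real.sin_two_mul, Real.cos_two_mul, Real.cos_sq'] at hker
  change ∑ j, fejerCoeff n j = 1
  rw [hsum, Real.tan_eq_sin_div_cos]
  set K := ∑ j ∈ range n, 2 * (n - j : ℝ) * Real.sin ((j + 1 : ℝ) * (2 * x))
  have hK : Real.sin x * K = (n + 1) * Real.cos x :=
    mul_left_cancel₀ (mul_ne_zero two_ne_zero hsin.ne') (by linear_combination hker)
  field_simp
  linear_combination hK

lemma sin_mul_cos_natCast_mul_pi (j : ℕ) (y : ℝ) :
    Real.sin ((j + 1 : ℝ) * y) * Real.cos ((j + 1 : ℝ) * Real.pi) =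
      Real.sin ((j + 1 : ℝ) * (y + Real.pi)) := by
  have h : Real.sin ((j + 1 : ℝ) * Real.pi) = 0 := by
    exact_mod_cast Real.sin_nat_mul_pi (j + 1)
  rw [mul_add, Real.sin_add, h, mul_zero, add_zero]

/-- Up to the factor `tan (θ / 2) / N`, the value at `π` is the conjugate Fejér kernel at `θ + π`,
`θ = π / N`. -/
lemma C_fejerCoeff_pi {n : ℕ} (hn : 1 ≤ n) :
    C (fejerCoeff n) Real.pi = -(Real.tan (Real.pi / (2 * ((n : ℝ) + 1)))) ^ 2 := by
  obtain ⟨h0, h1⟩ := half_angle_mem_Ioo hn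
  have hsum := sum_fejerCoeff_mul n fun j => Real.cos ((j + 1 : ℝ) * Real.pi)
  have hker := one_sub_cos_mul_conjFejerKernel n (Real.pi / (n + 1) + Real.pi)
  have hpi : Real.sin (((n : ℝ) + 1) * (Real.pi / (n + 1) + Real.pi)) = 0 := by
    have h : ((n : ℝ) + 1) * (Real.pi / (n + 1) + Real.pi) = (n + 2 : ℕ) * Real.pi := by
      push_cast
      field_simp
      ring
    rw [h, Real.sin_nat_mul_pi]
  have hθ : Real.pi / ((n : ℝ) + 1) = 2 * (Real.pi / (2 * ((n : ℝ) + 1))) := by field_simp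
  rw [hpi, sub_zero, Real.cos_add_pi, Real.sin_add_pi] at hker
  simp only [sin_mul_cos_natCast_mul_pi] at hsum
  rw [hθ] at hsum hker
  set x := Real.pi / (2 * ((n : ℝ) + 1)) with hx
  have hcos : 0 < Real.cos x := Real.cos_pos_of_mem_Ioo ⟨by linarith, h1⟩
  rw [Real.sin_two_mul, Real.cos_two_mul] at hker
  change ∑ j : Fin n, fejerCoeff n j * Real.cos (((j : ℕ) + 1 : ℝ) * Real.pi) = _
  rw [hsum, Real.tan_eq_sin_div_cos]
  set K := ∑ j ∈ range n, 2 * (n - j : ℝ) * Real.sin ((j + 1 : ℝ) * (2 * x + Real.pi))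
  have hK : Real.cos x * K = -((n + 1) * Real.sin x) :=
    mul_left_cancel₀ (mul_ne_zero two_ne_zero hcos.ne') (by linear_combination hker)
  field_simp
  linear_combination Real.sin x * hK

lemma S_fejerCoeff_eq (n : ℕ) (t : ℝ) :
    S (fejerCoeff n) t = Real.tan (Real.pi / (2 * ((n : ℝ) + 1))) / (n + 1) *
      ∑ j ∈ range n, 2 * (n - j : ℝ) *
        (Real.sin ((j + 1 : ℝ) * (Real.pi / (n + 1))) * Real.sin ((j + 1 : ℝ) * t)) :=
  sum_fejerCoeff_mul n fun j => Real.sin ((j + 1 : ℝ) * t)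

/-- The sum is half the difference of the Fejér kernels at `t - θ` and `t + θ`, `θ = π / N`; both
have the numerator `1 + cos (N t)`. -/
lemma sum_sin_mul_sin_mul_one_sub_cos (n : ℕ) (t : ℝ) :
    (∑ j ∈ range n, 2 * (n - j : ℝ) *
      (Real.sin ((j + 1 : ℝ) * (Real.pi / (n + 1))) * Real.sin ((j + 1 : ℝ) * t))) *
      ((1 - Real.cos (t - Real.pi / (n + 1))) * (1 - Real.cos (t + Real.pi / (n + 1)))) =
    (1 + Real.cos ((n + 1) * t)) * (Real.sin (Real.pi / (n + 1)) * Real.sin t) := by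
  set θ := Real.pi / ((n : ℝ) + 1) with hθ
  have hpi : ((n : ℝ) + 1) * θ = Real.pi := by
    rw [hθ]
    field_simp
  have hm := one_sub_cos_mul_fejerKernel n (t - θ)
  have hp := one_sub_cos_mul_fejerKernel n (t + θ)
  rw [mul_sub, hpi, Real.cos_sub_pi] at hm
  rw [mul_add ((n : ℝ) + 1), hpi, Real.cos_add_pi] at hp
  have hdiff : 2 * ∑ j ∈ range n, 2 * (n - j : ℝ) *
      (Real.sin ((j + 1 : ℝ) * θ) * Real.sin ((j + 1 : ℝ) * t)) =
      ∑ j ∈ range n, 2 * (n - j : ℝ) * Real.cos ((j + 1 : ℝ) * (t - θ)) -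
      ∑ j ∈ range n, 2 * (n - j : ℝ) * Real.cos ((j + 1 : ℝ) * (t + θ)) := by
    rw [mul_sum, ← sum_sub_distrib]
    refine sum_congr rfl fun j _ => ?_
    rw [mul_sub ((j : ℝ) + 1), mul_add ((j : ℝ) + 1), Real.cos_sub, Real.cos_add]
    ring
  have hcm := Real.cos_sub t θ
  have hcp := Real.cos_add t θ
  linear_combination ((1 - Real.cos (t - θ)) * (1 - Real.cos (t + θ)) / 2) * hdiff +
    (1 - Real.cos (t + θ)) / 2 * hm - (1 - Real.cos (t - θ)) / 2 * hp +
    (1 + Real.cos ((n + 1) * t)) / 2 * (hcm - hcp)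

lemma S_fejerCoeff_mul_sin_nonneg {n : ℕ} (hn : 1 ≤ n) (t : ℝ) :
    0 ≤ S (fejerCoeff n) t * Real.sin t := by
  obtain ⟨h0, h1⟩ := half_angle_mem_Ioo hn
  have htan := Real.tan_pos_of_pos_of_lt_pi_div_two h0 h1
  rw [S_fejerCoeff_eq, mul_assoc]
  refine mul_nonneg (by positivity) ?_
  have hmain := sum_sin_mul_sin_mul_one_sub_cos n t
  set θ := Real.pi / ((n : ℝ) + 1) with hθ
  have hsinθ : 0 ≤ Real.sin θ :=
    Real.sin_nonneg_of_nonneg_of_le_pi (by positivity)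
      (div_le_self Real.pi_pos.le (by linarith [n.cast_nonneg (α := ℝ)]))
  have hweight : ∀ j ∈ range n, (0 : ℝ) ≤ 2 * (n - j) := by
    intro j hj
    have : (j : ℝ) ≤ n := by exact_mod_cast (mem_range.mp hj).le
    linarith
  have hnm : ∀ j : ℕ, ∀ k : ℤ, (j + 1 : ℝ) * (k * (2 * Real.pi)) =
      (((j + 1 : ℕ) : ℤ) * k : ℤ) * (2 * Real.pi) := by
    intro j k
    push_cast
    ring
  -- Where a kernel is singular, `t = ±θ` modulo `2π`, and `±sin (j θ) sin (j t) = sin² (j θ)`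
  -- decides the sign; elsewhere the closed form does.
  rcases (sub_nonneg.mpr (Real.cos_le_one (t - θ))).eq_or_lt with hm | hm
  · obtain ⟨k, hk⟩ := (Real.cos_eq_one_iff _).mp (sub_eq_zero.mp hm.symm).symm
    obtain rfl : t = θ + k * (2 * Real.pi) := by linarith
    rw [Real.sin_add_int_mul_two_pi]
    refine mul_nonneg (sum_nonneg fun j hj => mul_nonneg (hweight j hj) ?_) hsinθ
    rw [mul_add, hnm, Real.sin_add_int_mul_two_pi]
    exact mul_self_nonneg _
  rcases (sub_nonneg.mpr (Real.cos_le_one (t + θ))).eq_or_lt with hp | hp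
  · obtain ⟨k, hk⟩ := (Real.cos_eq_one_iff _).mp (sub_eq_zero.mp hp.symm).symm
    obtain rfl : t = -θ + k * (2 * Real.pi) := by linarith
    rw [Real.sin_add_int_mul_two_pi, Real.sin_neg]
    refine mul_nonneg_of_nonpos_of_nonpos (sum_nonpos fun j hj =>
      mul_nonpos_of_nonneg_of_nonpos (hweight j hj) ?_) (by linarith)
    rw [mul_add, hnm, Real.sin_add_int_mul_two_pi, mul_neg, Real.sin_neg, mul_neg]
    exact neg_nonpos.mpr (mul_self_nonneg _)
  · refine nonneg_of_mul_nonneg_left ?_ (mul_pos hm hp)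
    rw [mul_right_comm, hmain, mul_assoc, mul_assoc]
    exact mul_nonneg (by linarith [Real.neg_one_le_cos ((n + 1) * t)])
      (mul_nonneg hsinθ (mul_self_nonneg _))

/-! ### The perturbed coefficients -/

lemma fejerPerturbed_mem_normalized {n : ℕ} (hn : 1 ≤ n) {ε : ℝ} (hε : 0 < ε) :
    fejerPerturbed n ε ∈ normalized n := by
  have h := sum_fejerPerturbed_mul hn ε fun _ => 1
  simp only [mul_one] at h
  change ∑ j, fejerPerturbed n ε j = 1
  rw [h, show ∑ j, fejerCoeff n j = 1 from fejerCoeff_mem_normalized hn]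
  exact div_self (by positivity)

lemma S_pi {n : ℕ} (a : Fin n → ℝ) : S a Real.pi = 0 := by
  refine sum_eq_zero fun j _ => ?_
  have : Real.sin (((j : ℕ) + 1 : ℝ) * Real.pi) = 0 := by
    exact_mod_cast Real.sin_nat_mul_pi (j + 1)
  rw [this, mul_zero]

/-- Multiplied by `sin t`, the sine polynomial is a nonnegative quantity plus `ε sin² t`, up to a
positive factor. -/
lemma sin_eq_zero_of_S_fejerPerturbed {n : ℕ} (hn : 1 ≤ n) {ε : ℝ} (hε : 0 < ε) {t : ℝ}
    (ht : S (fejerPerturbed n ε) t = 0) : Real.sin t = 0 := by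
  have h : S (fejerPerturbed n ε) t = (S (fejerCoeff n) t + ε * Real.sin t) / (1 + ε) := by
    have := sum_fejerPerturbed_mul hn ε fun j => Real.sin ((j + 1 : ℝ) * t)
    simpa [S] using this
  rw [h, div_eq_zero_iff, or_iff_left (by positivity)] at ht
  have h1 := S_fejerCoeff_mul_sin_nonneg hn t
  have h2 : ε * Real.sin t ^ 2 ≤ 0 := by
    have : S (fejerCoeff n) t * Real.sin t + ε * Real.sin t ^ 2 = 0 := by
      linear_combination Real.sin t * ht
    linarith
  exact pow_eq_zero_iff two_ne_zero |>.mp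
    (le_antisymm (nonpos_of_mul_nonpos_right h2 hε) (sq_nonneg _))

lemma C_fejerPerturbed_pi {n : ℕ} (hn : 1 ≤ n) (ε : ℝ) :
    C (fejerPerturbed n ε) Real.pi =
      (-(Real.tan (Real.pi / (2 * ((n : ℝ) + 1)))) ^ 2 - ε) / (1 + ε) := by
  have h := sum_fejerPerturbed_mul hn ε fun j => Real.cos ((j + 1 : ℝ) * Real.pi)
  rw [← C_fejerCoeff_pi hn]
  refine h.trans ?_
  rw [Nat.cast_zero, zero_add, one_mul, Real.cos_pi, mul_neg_one, ← sub_eq_add_neg]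
  rfl

lemma C_add_int_mul_two_pi {n : ℕ} (a : Fin n → ℝ) (t : ℝ) (k : ℤ) :
    C a (t + k * (2 * Real.pi)) = C a t :=
  (C_periodic a).int_mul k t

lemma rho_fejerPerturbed {n : ℕ} (hn : 1 ≤ n) {ε : ℝ} (hε : 0 < ε) :
    rho (fejerPerturbed n ε) =
      (-(Real.tan (Real.pi / (2 * ((n : ℝ) + 1)))) ^ 2 - ε) / (1 + ε) := by
  rw [← C_fejerPerturbed_pi hn ε]
  refine IsLeast.csInf_eq ⟨⟨Real.pi, S_pi _, rfl⟩, ?_⟩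
  rintro x ⟨t, ht, rfl⟩
  obtain ⟨m, rfl⟩ := Real.sin_eq_zero_iff.mp (sin_eq_zero_of_S_fejerPerturbed hn hε ht)
  rcases m.even_or_odd' with ⟨k, rfl | rfl⟩
  · have h : ((2 * k : ℤ) : ℝ) * Real.pi = 0 + k * (2 * Real.pi) := by
      push_cast
      ring
    rw [h, C_add_int_mul_two_pi, C_zero (fejerPerturbed_mem_normalized hn hε),
      C_fejerPerturbed_pi hn, div_le_one (by positivity)]
    nlinarith [sq_nonneg (Real.tan (Real.pi / (2 * ((n : ℝ) + 1))))]
  · have h : ((2 * k + 1 : ℤ) : ℝ) * Real.pi = Real.pi + k * (2 * Real.pi) := by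
      push_cast
      ring
    rw [h, C_add_int_mul_two_pi]

lemma tendsto_rho_fejerPerturbed {n : ℕ} (hn : 1 ≤ n) :
    Tendsto (fun ε : ℝ => rho (fejerPerturbed n ε)) (𝓝[>] 0)
      (𝓝 (-(Real.tan (Real.pi / (2 * ((n : ℝ) + 1)))) ^ 2)) := by
  set τ := Real.tan (Real.pi / (2 * ((n : ℝ) + 1)))
  have hlim : Tendsto (fun ε : ℝ => (-τ ^ 2 - ε) / (1 + ε)) (𝓝[>] 0) (𝓝 (-τ ^ 2)) := by
    have hcont : ContinuousAt (fun ε : ℝ => (-τ ^ 2 - ε) / (1 + ε)) 0 :=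
      ContinuousAt.div (by fun_prop) (by fun_prop) (by norm_num)
    simpa using hcont.tendsto.mono_left nhdsWithin_le_nhds
  refine hlim.congr' ?_
  filter_upwards [self_mem_nhdsWithin] with ε hε
  exact (rho_fejerPerturbed hn hε).symm

end ConjugateTrig

theorem mainTheorem1 (n : ℕ) (hn : 1 ≤ n) :
    (∀ a ∈ ConjugateTrig.normalized n,
      IsLeast (ConjugateTrig.valuesAtZeros a) (ConjugateTrig.rho a)) ∧
    IsLUB (ConjugateTrig.rho '' ConjugateTrig.normalized n)
      (-(Real.tan (Real.pi / (2 * ((n : ℝ) + 1)))) ^ 2) ∧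
    ConjugateTrig.fejerCoeff n ∈ ConjugateTrig.normalized n ∧
    (∀ ε : ℝ, 0 < ε → ConjugateTrig.fejerPerturbed n ε ∈ ConjugateTrig.normalized n) ∧
    Tendsto (fun ε : ℝ => ConjugateTrig.rho (ConjugateTrig.fejerPerturbed n ε)) (𝓝[>] 0)
      (𝓝 (-(Real.tan (Real.pi / (2 * ((n : ℝ) + 1)))) ^ 2)) := by
  have htend := ConjugateTrig.tendsto_rho_fejerPerturbed hn
  refine ⟨fun a _ => ConjugateTrig.isLeast_rho a, ⟨?_, fun b hb => ?_⟩,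
    ConjugateTrig.fejerCoeff_mem_normalized hn,
    fun ε hε => ConjugateTrig.fejerPerturbed_mem_normalized hn hε, htend⟩
  · rintro _ ⟨a, ha, rfl⟩
    exact ConjugateTrig.rho_le hn ha
  · refine le_of_tendsto htend ?_
    filter_upwards [self_mem_nhdsWithin] with ε hε
    exact hb ⟨_, ConjugateTrig.fejerPerturbed_mem_normalized hn hε, rfl⟩
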